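/- For integers $n,p\ge 1$ let $l_{ij}:\mathbb R^2\to\mathbb R$ $(1\le i\ne j\le p)$ be smooth functions, let $Y_{ij}$ $(1\le i\neq j\le p)$ be real random variables on a common probability space, and put $$L(\theta)=\frac1p\sum_{1\le i\ne j\le p} l_{ij}(\theta_i,\theta_j)\,Y_{ij},\qquad \theta\in\mathbb R^p .$$ For $\alpha>0$ and $b_{(p)},\sigma_{(p)}\ge 0$ (which may depend on $n$ and $p$) consider the conditions: (L-A1) for all $i\ne j$, all integers $k\ge1$ and $0\le s\le k$, and all $(x,y)\in\mathbb R^2$, $\displaystyle\left|\frac{\partial^k l_{ij}(x,y)}{\partial x^s\,\partial y^{k-s}}\right|\le\frac{(k-1)!}{\alpha^k}$; (L-A2) the $Y_{ij}$, $i\ne j$, are independent with $\mathbb E\,Y_{ij}=0$, $|Y_{ij}|\le b_{(p)}$ almost surely and $\operatorname{Var}(Y_{ij})\le\sigma_{(p)}^2$. Theorem. Let $\alpha>0$ and $\alpha_0\in(0,\alpha/2)$. For every $c>0$ there are a constant $C>0$ and an integer $N$, depending only on $\alpha,\alpha_0,c$, such that for all $n,p\ge1$ with $np\ge N$, all $l_{ij}$,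 $Y_{ij}$, $b_{(p)}$, $\sigma_{(p)}$ satisfying (L-A1) and (L-A2), and every $\theta'\in\mathbb R^p$, with probability greater than $1-(np)^{-c}$ the inequality $$|L(\theta)-L(\theta')|\le C\,\frac{b_{(p)}\log(np)+\sigma_{(p)}\sqrt{p\log(np)}}{p}\,\|\theta-\theta'\|_1$$ holds simultaneously for all $\theta\in\mathbb R^p$ with $\|\theta-\theta'\|_\infty\le\alpha_0$. -/

import Mathlib

open MeasureTheory ProbabilityTheory

/-- The mixed partial derivative `∂^(s+t) f / ∂x^s ∂y^t` of a function of two real variables,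
evaluated at `(x, y)`. -/
noncomputable def mixedPartial (f : ℝ → ℝ → ℝ) (s t : ℕ) (x y : ℝ) : ℝ :=
  iteratedDeriv s (fun u : ℝ => iteratedDeriv t (fun v : ℝ => f u v) y) x

/-- Condition (L-A1) with constant `α`: for all `i ≠ j` the function `l i j` is smooth on `ℝ²`, and
each of its partial derivatives of order `k ≥ 1` is bounded in absolute value by `(k-1)! / α^k`. -/
def CondLA1 {p : ℕ} (α : ℝ) (l : Fin p → Fin p → ℝ → ℝ → ℝ) : Prop :=
  ∀ i j : Fin p, i ≠ j →
    ContDiff ℝ (⊤ : ℕ∞) (fun q : ℝ × ℝ => l i j q.1 q.2) ∧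
    ∀ k : ℕ, 1 ≤ k → ∀ s : ℕ, s ≤ k → ∀ x y : ℝ,
      |mixedPartial (l i j) s (k - s) x y| ≤ (Nat.factorial (k - 1) : ℝ) / α ^ k

/-- Condition (L-A2) with constants `b` and `σ`: the off-diagonal `Y i j` are independent centred
random variables, bounded by `b` and with variance at most `σ²`. -/
structure CondLA2 {p : ℕ} {Ω : Type*} [MeasurableSpace Ω] (P : Measure Ω) (b σ : ℝ)
    (Y : Fin p → Fin p → Ω → ℝ) : Prop where
  b_nonneg : 0 ≤ b
  σ_nonneg : 0 ≤ σ
  measurable : ∀ i j : Fin p, i ≠ j → Measurable (Y i j)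
  indep : iIndepFun (fun (q : {q : Fin p × Fin p // q.1 ≠ q.2}) => Y q.1.1 q.1.2) P
  centered : ∀ i j : Fin p, i ≠ j → ∫ ω, Y i j ω ∂P = 0
  bounded : ∀ i j : Fin p, i ≠ j → ∀ᵐ ω ∂P, |Y i j ω| ≤ b
  variance_le : ∀ i j : Fin p, i ≠ j → variance (Y i j) P ≤ σ ^ 2

/-- `L(θ) = p⁻¹ ∑_{i ≠ j} l_{ij}(θ_i, θ_j) Y_{ij}`, at the outcome `ω`. -/
noncomputable def pairSum {p : ℕ} {Ω : Type*} (l : Fin p → Fin p → ℝ → ℝ → ℝ)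
    (Y : Fin p → Fin p → Ω → ℝ) (θ : Fin p → ℝ) (ω : Ω) : ℝ :=
  (1 / (p : ℝ)) * ∑ q ∈ (Finset.univ : Finset (Fin p)).offDiag,
    l q.1 q.2 (θ q.1) (θ q.2) * Y q.1 q.2 ω

/-! Put `d = θ - θ'`. By `sub_eq_integral_partial`, the increment of each `l i j` is the integral of
its first partial over `[0, d i]`, plus that of its second partial over `[0, d j]`, plus a double
integral of the mixed partial over the rectangle they span. After weighting by `Y` and summing, the
single integrals group by rows and columns, so they cost `‖d‖₁` times the supremum of a
one-parameter family of row or column sums.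

For the mixed part, interchange sum and integrals: at heights `(t, r)` there remains a sum over `S ×
T`, where `S` and `T` collect the indices whose interval between `0` and `d i` contains `t`,
respectively `r`. If every such rectangular sum is at most `K (|S| + |T|)`, integration gives `4 a K
‖d‖₁`, since `|S|` integrates to `‖d‖₁` (`abs_sum_iterated_integral_le`).

The rectangle bound must hold for exponentially many `(S, T)` at once. With `m = |S| + |T|`,
Bernstein at level `m A log(np)` fails with probability of order `exp(-A log(np)) ^ m`, which beats
the number of rectangles of size `m`; as a rectangle has at most `p m` cells, the allowed deviation
stays linear in `m` (`measureReal_exists_abs_sum_gt_le`, `measureReal_grid_failure_le`). A grid of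
step `α₀ / p` reduces the continuum of heights to finitely many, and `abs_sum_increment_le` is the
deterministic conclusion. Only partial derivatives up to order three enter. -/

/-! ### Exponential moments and Bernstein's inequality. -/

section Bernstein

variable {Ω : Type*} [MeasurableSpace Ω] {P : Measure Ω} [IsProbabilityMeasure P]

/-- For `|u| ≤ 1` one has `exp u ≤ 1 + u + u²`; with `u = t X` the linear term integrates to zero.
The condition `t * B ≤ 1` keeps `u` in that range. -/
theorem mgf_le_exp_sq_of_abs_le {X : Ω → ℝ} {B s t : ℝ} (hX : Measurable X)
    (hB : ∀ᵐ ω ∂P, |X ω| ≤ B) (h0 : ∫ ω, X ω ∂P = 0) (hs : variance X P ≤ s ^ 2)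
    (ht : 0 ≤ t) (htB : t * B ≤ 1) :
    mgf X P t ≤ Real.exp (t ^ 2 * s ^ 2) := by
  have hint : Integrable X P := .of_bound hX.aestronglyMeasurable B hB
  have hint2 : Integrable (fun ω => X ω ^ 2) P := by
    refine .of_bound (hX.pow_const 2).aestronglyMeasurable (B ^ 2) ?_
    filter_upwards [hB] with ω hω
    rw [Real.norm_eq_abs, abs_pow]
    exact pow_le_pow_left₀ (abs_nonneg _) hω 2
  have hpt : ∀ᵐ ω ∂P, Real.exp (t * X ω) ≤ 1 + t * X ω + t ^ 2 * X ω ^ 2 := by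
    filter_upwards [hB] with ω hω
    have h1 : |t * X ω| ≤ 1 := by
      rw [abs_mul, abs_of_nonneg ht]
      exact (mul_le_mul_of_nonneg_left hω ht).trans htB
    have h2 := (abs_le.mp (Real.abs_exp_sub_one_sub_id_le h1)).2
    rw [mul_pow] at h2
    linarith
  have hexp : Integrable (fun ω => Real.exp (t * X ω)) P := by
    refine .of_bound (by fun_prop) (Real.exp 1) ?_
    filter_upwards [hB] with ω hω
    rw [Real.norm_eq_abs, Real.abs_exp]
    exact Real.exp_le_exp.mpr
      ((mul_le_mul_of_nonneg_left ((le_abs_self _).trans hω) ht).trans htB)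
  have hvar : variance X P = ∫ ω, X ω ^ 2 ∂P :=
    variance_of_integral_eq_zero hX.aemeasurable h0
  have hlin : Integrable (fun ω => 1 + t * X ω) P := (integrable_const 1).add (hint.const_mul t)
  calc mgf X P t = ∫ ω, Real.exp (t * X ω) ∂P := rfl
    _ ≤ ∫ ω, (1 + t * X ω + t ^ 2 * X ω ^ 2) ∂P :=
      integral_mono_ae hexp (hlin.add (hint2.const_mul _)) hpt
    _ = 1 + t ^ 2 * variance X P := by
      rw [integral_add hlin (hint2.const_mul _),
        integral_add (integrable_const 1) (hint.const_mul t), integral_const_mul,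
        integral_const_mul, h0, hvar]
      simp
    _ ≤ t ^ 2 * s ^ 2 + 1 := by nlinarith [sq_nonneg t]
    _ ≤ Real.exp (t ^ 2 * s ^ 2) := Real.add_one_le_exp _

/-- One-sided Bernstein inequality. -/
theorem measureReal_sum_gt_le {ι : Type*} {X : ι → Ω → ℝ} {B v τ : ℝ}
    (hX : ∀ i, Measurable (X i)) (hind : iIndepFun X P)
    (hB0 : 0 ≤ B) (hv0 : 0 ≤ v)
    (hB : ∀ i, ∀ᵐ ω ∂P, |X i ω| ≤ B) (h0 : ∀ i, ∫ ω, X i ω ∂P = 0)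
    (hv : ∀ i, variance (X i) P ≤ v ^ 2) (s : Finset ι) (hτ : 0 < τ) :
    P.real {ω | 2 * (B * τ + v * √(s.card * τ)) < ∑ i ∈ s, X i ω} ≤ Real.exp (-τ) := by
  -- The Chernoff parameter is `1 / r`. This `r` makes `B / r ≤ 1` and the mgf exponent at most `τ`,
  -- while `r * τ` is at most half the threshold; the total exponent is then at most `-2τ + τ`.
  set r := max B (v * √s.card / √τ) with hr
  have hsτ : 0 < √τ := Real.sqrt_pos.mpr hτ
  have hsτ2 : √τ * √τ = τ := Real.mul_self_sqrt hτ.le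
  have hN : √(s.card : ℝ) * √s.card = s.card := Real.mul_self_sqrt (by positivity)
  rw [Real.sqrt_mul (by positivity)]
  -- If `r = 0` then `B = 0`, so the sum is almost surely nonpositive and the event is null.
  rcases eq_or_lt_of_le (hB0.trans (le_max_left B (v * √s.card / √τ))) with hr0 | hr0
  · have hBz : B = 0 := le_antisymm (hr0 ▸ le_max_left _ _) hB0
    have hall : ∀ᵐ ω ∂P, ∀ i ∈ s, |X i ω| ≤ B :=
      (Finset.eventually_all s).mpr fun i _ => hB i
    have hz : P {ω | 2 * (B * τ + v * (√s.card * √τ)) < ∑ i ∈ s, X i ω} = 0 := by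
      refine measure_mono_null ?_ hall
      intro ω hω hω'
      have : ∑ i ∈ s, X i ω ≤ 0 :=
        Finset.sum_nonpos fun i hi => (le_abs_self _).trans ((hω' i hi).trans hBz.le)
      have h2 : 0 ≤ 2 * (B * τ + v * (√s.card * √τ)) :=
        mul_nonneg zero_le_two (add_nonneg (mul_nonneg hB0 hτ.le)
          (mul_nonneg hv0 (mul_nonneg (Real.sqrt_nonneg _) (Real.sqrt_nonneg _))))
      exact (h2.trans_lt hω).not_ge this
    rw [measureReal_def, hz]
    simp [Real.exp_nonneg]
  · rw [← hr] at hr0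
    have hrB : B ≤ r := le_max_left _ _
    have hrv : v * √s.card ≤ r * √τ := by
      rw [← div_le_iff₀ hsτ]; exact le_max_right _ _
    have ht : 0 ≤ 1 / r := by positivity
    have htB : 1 / r * B ≤ 1 := by rw [one_div, inv_mul_le_iff₀ hr0]; linarith
    have hmgf : mgf (∑ i ∈ s, X i) P (1 / r) ≤ Real.exp (s.card * ((1 / r) ^ 2 * v ^ 2)) := by
      rw [hind.mgf_sum hX]
      calc ∏ i ∈ s, mgf (X i) P (1 / r) ≤ ∏ _i ∈ s, Real.exp ((1 / r) ^ 2 * v ^ 2) :=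
            Finset.prod_le_prod (fun _ _ => mgf_nonneg) fun i _ =>
              mgf_le_exp_sq_of_abs_le (hX i) (hB i) (h0 i) (hv i) ht htB
        _ = _ := by rw [Finset.prod_const, ← Real.exp_nat_mul]
    have hint : Integrable (fun ω => Real.exp (1 / r * (∑ i ∈ s, X i) ω)) P := by
      refine hind.integrable_exp_mul_sum hX fun i _ => ?_
      refine .of_bound (by have := hX i; fun_prop) (Real.exp (1 / r * B)) ?_
      filter_upwards [hB i] with ω hω
      rw [Real.norm_eq_abs, Real.abs_exp]
      exact Real.exp_le_exp.mpr (mul_le_mul_of_nonneg_left ((le_abs_self _).trans hω) ht)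
    have hch := measure_ge_le_exp_mul_mgf (2 * (B * τ + v * (√s.card * √τ))) ht hint
    calc P.real {ω | 2 * (B * τ + v * (√s.card * √τ)) < ∑ i ∈ s, X i ω}
        ≤ P.real {ω | 2 * (B * τ + v * (√s.card * √τ)) ≤ (∑ i ∈ s, X i) ω} := by
          refine measureReal_mono fun ω hω => ?_
          simp only [Set.mem_ofPred_eq, Finset.sum_apply] at hω ⊢
          exact hω.le
      _ ≤ _ := hch
      _ ≤ Real.exp (-(1 / r) * (2 * (B * τ + v * (√s.card * √τ)))) *
          Real.exp (s.card * ((1 / r) ^ 2 * v ^ 2)) := by gcongr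
      _ ≤ Real.exp (-τ) := by
        rw [← Real.exp_add]
        refine Real.exp_le_exp.mpr ?_
        have e1 : s.card * ((1 / r) ^ 2 * v ^ 2) = (v * √s.card / r) ^ 2 := by
          calc s.card * ((1 / r) ^ 2 * v ^ 2) = √s.card * √s.card * ((1 / r) ^ 2 * v ^ 2) := by rw [hN]
            _ = (v * √s.card / r) ^ 2 := by ring
        have e2 : v * √s.card / r ≤ √τ := by
          rw [div_le_iff₀ hr0]; linarith
        have e3 : 0 ≤ v * √s.card / r := by positivity
        have e4 : (v * √s.card / r) ^ 2 ≤ τ := by rw [← hsτ2, sq]; gcongr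
        have e5 : r * τ ≤ B * τ + v * (√s.card * √τ) := by
          rcases max_choice B (v * √s.card / √τ) with h | h
          · rw [← hr] at h
            rw [h]
            have : 0 ≤ v * (√s.card * √τ) := by positivity
            linarith
          · rw [← hr] at h
            have : r * τ = v * (√s.card * √τ) := by
              rw [h]; nth_rewrite 2 [← hsτ2]; field_simp
            rw [this]
            have : 0 ≤ B * τ := by positivity
            linarith
        have e6 : τ ≤ 1 / r * (B * τ + v * (√s.card * √τ)) := by
          rw [one_div, ← div_eq_inv_mul, le_div_iff₀ hr0]; linarith
        rw [e1]
        linarith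

/-- Two-sided Bernstein inequality for a weighted sum. -/
theorem measureReal_abs_sum_mul_gt_le {ι : Type*} {Y : ι → Ω → ℝ} {b σ M τ : ℝ}
    (hY : ∀ i, Measurable (Y i)) (hind : iIndepFun Y P)
    (hb : 0 ≤ b) (hσ : 0 ≤ σ) (hM : 0 ≤ M)
    (hB : ∀ i, ∀ᵐ ω ∂P, |Y i ω| ≤ b) (h0 : ∀ i, ∫ ω, Y i ω ∂P = 0)
    (hv : ∀ i, variance (Y i) P ≤ σ ^ 2) {w : ι → ℝ} (hw : ∀ i, |w i| ≤ M)
    (s : Finset ι) (hτ : 0 < τ) :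
    P.real {ω | 2 * M * (b * τ + σ * √(s.card * τ)) < |∑ i ∈ s, w i * Y i ω|}
      ≤ 2 * Real.exp (-τ) := by
  have key : ∀ w : ι → ℝ, (∀ i, |w i| ≤ M) →
      P.real {ω | 2 * (M * b * τ + M * σ * √(s.card * τ)) < ∑ i ∈ s, w i * Y i ω}
        ≤ Real.exp (-τ) := by
    intro w hw
    refine measureReal_sum_gt_le (X := fun i ω => w i * Y i ω) (fun i => (hY i).const_mul _)
      (hind.comp (fun i y => w i * y) fun i => measurable_const_mul _) (by positivity)
      (by positivity) ?_ ?_ ?_ s hτ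
    · intro i
      filter_upwards [hB i] with ω hω
      rw [abs_mul]
      exact mul_le_mul (hw i) hω (abs_nonneg _) hM
    · intro i
      rw [integral_const_mul, h0, mul_zero]
    · intro i
      rw [variance_const_mul, mul_pow]
      have : w i ^ 2 ≤ M ^ 2 := sq_le_sq' (by linarith [abs_le.mp (hw i)]) (abs_le.mp (hw i)).2
      exact mul_le_mul this (hv i) (variance_nonneg _ _) (by positivity)
  calc P.real {ω | 2 * M * (b * τ + σ * √(s.card * τ)) < |∑ i ∈ s, w i * Y i ω|}
      ≤ P.real ({ω | 2 * (M * b * τ + M * σ * √(s.card * τ)) < ∑ i ∈ s, w i * Y i ω} ∪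
          {ω | 2 * (M * b * τ + M * σ * √(s.card * τ)) < ∑ i ∈ s, (-w i) * Y i ω}) := by
        refine measureReal_mono fun ω hω => ?_
        simp only [Set.mem_ofPred_eq, Set.mem_union, neg_mul, Finset.sum_neg_distrib] at hω ⊢
        have e : 2 * (M * b * τ + M * σ * √(s.card * τ)) =
          2 * M * (b * τ + σ * √(s.card * τ)) := by ring
        rw [e]
        exact lt_abs.mp hω
    _ ≤ _ := measureReal_union_le _ _
    _ ≤ 2 * Real.exp (-τ) := by
        linarith [key w hw, key (fun i => -w i) fun i => by rw [abs_neg]; exact hw i]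

end Bernstein

/-! ### Partial derivatives and increments in two variables. -/

/-- Partial derivative in the first variable. -/
noncomputable def partialFst (f : ℝ × ℝ → ℝ) (q : ℝ × ℝ) : ℝ := fderiv ℝ f q (1, 0)

/-- Partial derivative in the second variable. -/
noncomputable def partialSnd (f : ℝ × ℝ → ℝ) (q : ℝ × ℝ) : ℝ := fderiv ℝ f q (0, 1)

section PartialDerivatives

variable {f : ℝ × ℝ → ℝ}

theorem ContDiff.partialFst (hf : ContDiff ℝ (⊤ : ℕ∞) f) :
    ContDiff ℝ (⊤ : ℕ∞) (partialFst f) :=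
  (hf.fderiv_right (m := (⊤ : ℕ∞)) (by simp)).clm_apply contDiff_const

theorem ContDiff.partialSnd (hf : ContDiff ℝ (⊤ : ℕ∞) f) :
    ContDiff ℝ (⊤ : ℕ∞) (partialSnd f) :=
  (hf.fderiv_right (m := (⊤ : ℕ∞)) (by simp)).clm_apply contDiff_const

theorem hasDerivAt_partialFst (hf : ContDiff ℝ (⊤ : ℕ∞) f) (x y : ℝ) :
    HasDerivAt (fun u => f (u, y)) (partialFst f (x, y)) x := by
  have h1 : HasFDerivAt f (fderiv ℝ f (x, y)) (x, y) :=
    (hf.differentiable (by simp) _).hasFDerivAt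
  exact h1.comp_hasDerivAt x ((hasDerivAt_id x).prodMk (hasDerivAt_const x y))

theorem hasDerivAt_partialSnd (hf : ContDiff ℝ (⊤ : ℕ∞) f) (x y : ℝ) :
    HasDerivAt (fun v => f (x, v)) (partialSnd f (x, y)) y := by
  have h1 : HasFDerivAt f (fderiv ℝ f (x, y)) (x, y) :=
    (hf.differentiable (by simp) _).hasFDerivAt
  exact h1.comp_hasDerivAt y ((hasDerivAt_const y x).prodMk (hasDerivAt_id y))

theorem partialFst_partialSnd_comm (hf : ContDiff ℝ (⊤ : ℕ∞) f) :
    partialFst (partialSnd f) = partialSnd (partialFst f) := by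
  ext q
  have hd : DifferentiableAt ℝ (fderiv ℝ f) q :=
    (hf.fderiv_right (m := (⊤ : ℕ∞)) (by simp)).differentiable (by simp) q
  have hs : IsSymmSndFDerivAt ℝ f q :=
    hf.contDiffAt.isSymmSndFDerivAt (by
      rw [minSmoothness_of_isRCLikeNormedField]; exact WithTop.coe_le_coe.mpr le_top)
  have e : ∀ v w : ℝ × ℝ, fderiv ℝ (fun q => fderiv ℝ f q v) q w = fderiv ℝ (fderiv ℝ f) q w v := by
    intro v w
    rw [fderiv_clm_apply hd (differentiableAt_const v)]
    simp
  change fderiv ℝ (fun q => fderiv ℝ f q (0, 1)) q (1, 0) =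
    fderiv ℝ (fun q => fderiv ℝ f q (1, 0)) q (0, 1)
  rw [e, e]
  exact hs.eq _ _

/-- Transfers the bounds of (L-A1), phrased with one-variable iterated derivatives, to the
Fréchet-based operators used for the expansion. -/
theorem mixedPartial_eq_iterate {l : ℝ → ℝ → ℝ}
    (hl : ContDiff ℝ (⊤ : ℕ∞) fun q : ℝ × ℝ => l q.1 q.2) (s t : ℕ) (x y : ℝ) :
    mixedPartial l s t x y = (partialFst^[s] (partialSnd^[t] fun q => l q.1 q.2)) (x, y) := by
  have h2 : ∀ t : ℕ, ContDiff ℝ (⊤ : ℕ∞) (partialSnd^[t] fun q => l q.1 q.2) ∧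
      ∀ u y, iteratedDeriv t (fun v => l u v) y = (partialSnd^[t] fun q => l q.1 q.2) (u, y) := by
    intro t
    induction t with
    | zero => exact ⟨hl, fun u y => by simp⟩
    | succ t ih =>
      rw [Function.iterate_succ_apply']
      refine ⟨ih.1.partialSnd, fun u y => ?_⟩
      rw [iteratedDeriv_succ, ← (hasDerivAt_partialSnd ih.1 u y).deriv]
      congr 1
      ext v
      exact ih.2 u v
  have h1 : ∀ g : ℝ × ℝ → ℝ, ContDiff ℝ (⊤ : ℕ∞) g → ∀ s : ℕ,
      ContDiff ℝ (⊤ : ℕ∞) (partialFst^[s] g) ∧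
      ∀ x y, iteratedDeriv s (fun u => g (u, y)) x = (partialFst^[s] g) (x, y) := by
    intro g hg s
    induction s with
    | zero => exact ⟨hg, fun u y => by simp⟩
    | succ s ih =>
      rw [Function.iterate_succ_apply']
      refine ⟨ih.1.partialFst, fun x y => ?_⟩
      rw [iteratedDeriv_succ, ← (hasDerivAt_partialFst ih.1 x y).deriv]
      congr 1
      ext v
      exact ih.2 v y
  rw [mixedPartial, ← (h1 _ (h2 t).1 s).2 x y]
  congr 1
  ext u
  exact (h2 t).2 u y

theorem abs_sub_le_of_partialFst_le (hf : ContDiff ℝ (⊤ : ℕ∞) f) {M : ℝ}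
    (hM : ∀ q, |partialFst f q| ≤ M) (x x' y : ℝ) :
    |f (x, y) - f (x', y)| ≤ M * |x - x'| := by
  have := Convex.norm_image_sub_le_of_norm_hasDerivWithin_le (f := fun u => f (u, y)) (s := Set.univ)
    (x := x') (y := x) (fun u _ => (hasDerivAt_partialFst hf u y).hasDerivWithinAt)
    (fun u _ => hM (u, y)) convex_univ (Set.mem_univ _) (Set.mem_univ _)
  exact this

theorem abs_sub_le_of_partialSnd_le (hf : ContDiff ℝ (⊤ : ℕ∞) f) {M : ℝ}
    (hM : ∀ q, |partialSnd f q| ≤ M) (x y y' : ℝ) :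
    |f (x, y) - f (x, y')| ≤ M * |y - y'| := by
  have := Convex.norm_image_sub_le_of_norm_hasDerivWithin_le (f := fun u => f (x, u)) (s := Set.univ)
    (x := y') (y := y) (fun u _ => (hasDerivAt_partialSnd hf x u).hasDerivWithinAt)
    (fun u _ => hM (x, u)) convex_univ (Set.mem_univ _) (Set.mem_univ _)
  exact this

theorem integral_partialFst (hf : ContDiff ℝ (⊤ : ℕ∞) f) (x y d : ℝ) :
    ∫ t in (0 : ℝ)..d, partialFst f (x + t, y) = f (x + d, y) - f (x, y) := by
  have hc := hf.partialFst.continuous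
  rw [intervalIntegral.integral_eq_sub_of_hasDerivAt (f := fun t => f (x + t, y))]
  · simp
  · intro t _
    exact (hasDerivAt_partialFst hf (x + t) y).comp_const_add x t
  · exact Continuous.intervalIntegrable (by fun_prop) _ _

theorem integral_partialSnd (hf : ContDiff ℝ (⊤ : ℕ∞) f) (x y d : ℝ) :
    ∫ t in (0 : ℝ)..d, partialSnd f (x, y + t) = f (x, y + d) - f (x, y) := by
  have hc := hf.partialSnd.continuous
  rw [intervalIntegral.integral_eq_sub_of_hasDerivAt (f := fun t => f (x, y + t))]
  · simp
  · intro t _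
    exact (hasDerivAt_partialSnd hf x (y + t)).comp_const_add y t
  · exact Continuous.intervalIntegrable (by fun_prop) _ _

/-- Increment of a function of two variables through integrals of its partial derivatives. -/
theorem sub_eq_integral_partial (hf : ContDiff ℝ (⊤ : ℕ∞) f) (x y d e : ℝ) :
    f (x + d, y + e) - f (x, y) =
      (∫ t in (0 : ℝ)..d, partialFst f (x + t, y)) + (∫ r in (0 : ℝ)..e, partialSnd f (x, y + r)) +
      ∫ t in (0 : ℝ)..d, ∫ r in (0 : ℝ)..e, partialSnd (partialFst f) (x + t, y + r) := by
  have hc := hf.partialFst.continuous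
  simp_rw [integral_partialSnd hf.partialFst]
  rw [intervalIntegral.integral_sub (Continuous.intervalIntegrable (by fun_prop) _ _)
    (Continuous.intervalIntegrable (by fun_prop) _ _), integral_partialFst hf,
    integral_partialFst hf, integral_partialSnd hf]
  ring

end PartialDerivatives

/-! ### Layer-cake bounds for sums of integrals. -/

section LayerCake

variable {ι : Type*}

open scoped Classical in
theorem integral_card_filter_uIoc (s : Finset ι) (d : ι → ℝ) {a : ℝ} (hd : ∀ i ∈ s, |d i| ≤ a) :
    Integrable (fun t => ((s.filter fun i => t ∈ Set.uIoc 0 (d i)).card : ℝ))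
        (volume.restrict (Set.Ioc (-a) a)) ∧
      ∫ t in Set.Ioc (-a) a, ((s.filter fun i => t ∈ Set.uIoc 0 (d i)).card : ℝ) =
        ∑ i ∈ s, |d i| := by
  have e : ∀ t, ((s.filter fun i => t ∈ Set.uIoc 0 (d i)).card : ℝ) =
      ∑ i ∈ s, (Set.uIoc 0 (d i)).indicator (fun _ => (1 : ℝ)) t := by
    intro t
    rw [Finset.card_filter]
    push_cast
    exact Finset.sum_congr rfl fun i _ => by simp [Set.indicator_apply]
  simp_rw [e]
  have hint : ∀ i ∈ s, Integrable ((Set.uIoc 0 (d i)).indicator (fun _ => (1 : ℝ)))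
      (volume.restrict (Set.Ioc (-a) a)) := fun i _ =>
    (integrable_const (1 : ℝ)).indicator measurableSet_uIoc
  refine ⟨integrable_finsetSum _ hint, ?_⟩
  rw [integral_finsetSum _ hint]
  refine Finset.sum_congr rfl fun i hi => ?_
  rw [setIntegral_indicator measurableSet_uIoc, Set.inter_eq_right.mpr]
  · simp [Set.uIoc, measureReal_def, max_sub_min_eq_abs]
  · obtain ⟨h1, h2⟩ := abs_le.mp (hd i hi)
    have : 0 ≤ a := (abs_nonneg _).trans (hd i hi)
    exact Set.Ioc_subset_Ioc (le_min (by linarith) h1) (max_le this h2)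

open scoped Classical in
/-- A sum of integrals over `[0, d i]` is an integral of partial sums of the integrands. -/
theorem abs_sum_intervalIntegral_le (s : Finset ι) (d : ι → ℝ) {a : ℝ}
    (hd : ∀ i ∈ s, |d i| ≤ a) (H : ι → ℝ → ℝ) (hH : ∀ i ∈ s, Continuous (H i)) (g : ℝ → ℝ)
    (hg : IntegrableOn g (Set.Ioc (-a) a))
    (hle : ∀ t ∈ Set.Ioc (-a) a, |∑ i ∈ s.filter fun i => t ∈ Set.uIoc 0 (d i), H i t| ≤ g t) :
    |∑ i ∈ s, ∫ t in (0 : ℝ)..d i, H i t| ≤ ∫ t in Set.Ioc (-a) a, g t := by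
  -- The orientation sign of the integral over `[0, d i]` depends only on the sign of `t`, not on
  -- `i`, so it factors out of the sum at fixed `t`. The point `t = 0` lies only in intervals `(d i,
  -- 0]`, hence the value `-1` there.
  set ε : ℝ → ℝ := fun t => if 0 < t then 1 else -1 with hε
  have hεm : Measurable ε := Measurable.ite measurableSet_Ioi measurable_const measurable_const
  have hε1 : ∀ t, |ε t| = 1 := by
    intro t
    simp only [hε]
    split_ifs <;> simp
  have hsub : ∀ i ∈ s, Set.uIoc 0 (d i) ⊆ Set.Ioc (-a) a := by
    intro i hi
    obtain ⟨h1, h2⟩ := abs_le.mp (hd i hi)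
    have : 0 ≤ a := (abs_nonneg _).trans (hd i hi)
    exact Set.Ioc_subset_Ioc (le_min (by linarith) h1) (max_le this h2)
  have hterm : ∀ i ∈ s, ∫ t in (0 : ℝ)..d i, H i t =
      ∫ t in Set.Ioc (-a) a, (Set.uIoc 0 (d i)).indicator (fun t => ε t * H i t) t := by
    intro i hi
    rw [setIntegral_indicator measurableSet_uIoc, Set.inter_eq_right.mpr (hsub i hi),
      intervalIntegral.intervalIntegral_eq_integral_uIoc, smul_eq_mul, ← integral_const_mul]
    refine setIntegral_congr_fun measurableSet_uIoc fun t ht => ?_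
    simp only [hε]
    rw [Set.mem_uIoc] at ht
    congr 1
    rcases ht with ⟨h1, h2⟩ | ⟨h1, h2⟩
    · rw [if_pos (by linarith), if_pos h1]
    · rw [if_neg (by linarith), if_neg (by linarith)]
  have hint : ∀ i ∈ s, Integrable ((Set.uIoc 0 (d i)).indicator (fun t => ε t * H i t))
      (volume.restrict (Set.Ioc (-a) a)) := by
    intro i hi
    refine Integrable.indicator ?_ measurableSet_uIoc
    have h1 : IntegrableOn (H i) (Set.Ioc (-a) a) :=
      ((hH i hi).integrableOn_Icc).mono_set Set.Ioc_subset_Icc_self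
    exact Integrable.bdd_mul (c := 1) h1 hεm.aestronglyMeasurable
      (Filter.Eventually.of_forall fun t => (hε1 t).le)
  rw [Finset.sum_congr rfl hterm, ← integral_finsetSum _ hint, ← Real.norm_eq_abs]
  refine norm_integral_le_of_norm_le hg ?_
  filter_upwards [ae_restrict_mem measurableSet_Ioc] with t ht
  have e : ∑ i ∈ s, (Set.uIoc 0 (d i)).indicator (fun t => ε t * H i t) t =
      ε t * ∑ i ∈ s.filter fun i => t ∈ Set.uIoc 0 (d i), H i t := by
    rw [Finset.mul_sum, Finset.sum_filter]
    exact Finset.sum_congr rfl fun i _ => by simp [Set.indicator_apply]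
  rw [e, norm_mul, Real.norm_eq_abs, Real.norm_eq_abs, hε1, one_mul]
  exact hle t ht

open scoped Classical in
/-- Bound on a bilinear layer-cake sum, given bounds on all its rectangular partial sums. -/
theorem abs_sum_iterated_integral_le {κ : Type*} [Fintype κ] [Fintype ι] [DecidableEq ι]
    (u v : κ → ι)
    (H : κ → ℝ → ℝ → ℝ) (hH : ∀ q, Continuous (Function.uncurry (H q))) (d : ι → ℝ) {a K : ℝ}
    (hd : ∀ i, |d i| ≤ a)
    (hK : ∀ t r : ℝ, |t| ≤ a → |r| ≤ a → ∀ S T : Finset ι,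
      |∑ q with u q ∈ S ∧ v q ∈ T, H q t r| ≤ K * (S.card + T.card)) :
    |∑ q, ∫ t in (0 : ℝ)..d (u q), ∫ r in (0 : ℝ)..d (v q), H q t r| ≤
      4 * a * K * ∑ i, |d i| := by
  rcases isEmpty_or_nonempty ι with hι | ⟨⟨i₀⟩⟩
  · have : IsEmpty κ := ⟨fun q => hι.elim (u q)⟩
    simp
  have ha : 0 ≤ a := (abs_nonneg _).trans (hd i₀)
  have hvol : volume.real (Set.Ioc (-a) a) = 2 * a := by
    rw [Real.volume_real_Ioc_of_le (by linarith)]; ring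
  have hmem : ∀ t ∈ Set.Ioc (-a) a, |t| ≤ a := fun t ht => abs_le.mpr ⟨ht.1.le, ht.2⟩
  obtain ⟨hci, hce⟩ := integral_card_filter_uIoc Finset.univ d (a := a) fun i _ => hd i
  set D := ∑ i, |d i| with hD
  set N : ℝ → ℝ := fun t => ((Finset.univ.filter fun i => t ∈ Set.uIoc 0 (d i)).card : ℝ) with hN
  -- Integrating `K (N t + N r)` over `r` gives `K (2 a N t + D)`; integrating over `t` then gives
  -- `K (2 a D + 2 a D)`, the source of `4 a K`.
  have hinner : ∀ t ∈ Set.Ioc (-a) a,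
      |∑ q with t ∈ Set.uIoc 0 (d (u q)), ∫ r in (0 : ℝ)..d (v q), H q t r| ≤
        K * (2 * a * N t + D) := by
    intro t ht
    refine (abs_sum_intervalIntegral_le _ (fun q => d (v q)) (fun q _ => hd (v q))
      (fun q r => H q t r) (fun q _ => (hH q).comp (Continuous.prodMk_right t)) (fun r => K * (N t + N r))
      (((integrable_const (N t)).add hci).const_mul K) ?_).trans_eq ?_
    · intro r hr
      have := hK t r (hmem t ht) (hmem r hr) (Finset.univ.filter fun i => t ∈ Set.uIoc 0 (d i))
        (Finset.univ.filter fun i => r ∈ Set.uIoc 0 (d i))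
      simpa [Finset.filter_filter, hN] using this
    · rw [integral_const_mul, integral_add (integrable_const _) hci, hce]
      simp [hvol]
  refine (abs_sum_intervalIntegral_le _ (fun q => d (u q)) (fun q _ => hd (u q))
      (fun q t => ∫ r in (0 : ℝ)..d (v q), H q t r) (fun q _ => ?_)
      (fun t => K * (2 * a * N t + D))
      (((hci.const_mul (2 * a)).add (integrable_const D)).const_mul K) hinner).trans_eq ?_
  · exact intervalIntegral.continuous_parametric_intervalIntegral_of_continuous' (hH q) _ _
  · rw [integral_const_mul, integral_add (hci.const_mul _) (integrable_const _),
      integral_const_mul, hce]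
    simp only [integral_const, MeasurableSet.univ, measureReal_restrict_apply, Set.univ_inter, hvol,
      smul_eq_mul]
    ring

end LayerCake

/-! ### Union bounds with deviation proportional to size. -/

section UnionBound

variable {Ω : Type*} [MeasurableSpace Ω] {P : Measure Ω} [IsProbabilityMeasure P]

/-- Union bound over a finite family of weighted sums, the sum of index `k` having at most `p * m k`
terms and being allowed a deviation proportional to `m k`. -/
theorem measureReal_exists_abs_sum_gt_le {ι κ : Type*} {Y : ι → Ω → ℝ} {b σ M A L p : ℝ}
    (hY : ∀ i, Measurable (Y i)) (hind : iIndepFun Y P)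
    (hb : 0 ≤ b) (hσ : 0 ≤ σ) (hM : 0 ≤ M) (hA : 1 ≤ A) (hL : 0 < L)
    (hB : ∀ i, ∀ᵐ ω ∂P, |Y i ω| ≤ b) (h0 : ∀ i, ∫ ω, Y i ω ∂P = 0)
    (hv : ∀ i, variance (Y i) P ≤ σ ^ 2) (F : Finset κ) {w : κ → ι → ℝ} (hw : ∀ k i, |w k i| ≤ M)
    (s : κ → Finset ι) (m : κ → ℕ) (hm : ∀ k ∈ F, 1 ≤ m k)
    (hs : ∀ k ∈ F, ((s k).card : ℝ) ≤ p * m k) :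
    P.real {ω | ∃ k ∈ F, 2 * M * A * (b * L + σ * √(p * L)) * m k < |∑ i ∈ s k, w k i * Y i ω|}
      ≤ ∑ k ∈ F, 2 * Real.exp (-(A * L)) ^ m k := by
  have hset : {ω | ∃ k ∈ F, 2 * M * A * (b * L + σ * √(p * L)) * m k <
        |∑ i ∈ s k, w k i * Y i ω|} =
      ⋃ k ∈ F, {ω | 2 * M * A * (b * L + σ * √(p * L)) * m k < |∑ i ∈ s k, w k i * Y i ω|} := by
    ext ω
    simp
  rw [hset]
  refine (measureReal_biUnion_finset_le _ _).trans (Finset.sum_le_sum fun k hk => ?_)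
  have hm1 : (1 : ℝ) ≤ m k := by exact_mod_cast hm k hk
  have hτ : 0 < m k * (A * L) := by positivity
  have h := measureReal_abs_sum_mul_gt_le hY hind hb hσ hM hB h0 hv (hw k) (s k) hτ
  have he : Real.exp (-(m k * (A * L))) = Real.exp (-(A * L)) ^ m k := by
    rw [← Real.exp_nat_mul]; ring_nf
  rw [he] at h
  refine (measureReal_mono fun ω hω => ?_).trans h
  rw [Set.mem_ofPred_eq] at hω ⊢
  refine lt_of_le_of_lt ?_ hω
  -- The factor `m k` leaves the root because both the number of terms and the level `τ` grow
  -- linearly in it; `1 ≤ A` replaces `A` by `A ^ 2`.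
  have hsq : √((s k).card * (m k * (A * L))) ≤ A * m k * √(p * L) := by
    rw [← Real.sqrt_sq (show 0 ≤ A * m k by positivity), ← Real.sqrt_mul (by positivity)]
    refine Real.sqrt_le_sqrt ?_
    calc (s k).card * (m k * (A * L)) ≤ p * m k * (m k * (A * L)) := by
          gcongr; exact hs k hk
      _ = A * (m k ^ 2 * (p * L)) := by ring
      _ ≤ A ^ 2 * (m k ^ 2 * (p * L)) := by
        have : 0 ≤ p := by
          by_contra hneg
          have := hs k hk
          have h3 : (0 : ℝ) ≤ (s k).card := by positivity
          nlinarith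
        gcongr
        nlinarith
      _ = (A * m k) ^ 2 * (p * L) := by ring
  calc 2 * M * (b * (m k * (A * L)) + σ * √((s k).card * (m k * (A * L))))
      ≤ 2 * M * (b * (m k * (A * L)) + σ * (A * m k * √(p * L))) := by gcongr
    _ = 2 * M * A * (b * L + σ * √(p * L)) * m k := by ring

/-- Over all pairs the sum factors as `(1 + x) ^ (2 |ι|)`, at most `exp (2 |ι| x)`. Removing the
empty pair subtracts `1`, and `exp y - 1 ≤ 2 y` for `0 ≤ y ≤ 1`. -/
theorem sum_pow_card_erase_empty_le {ι : Type*} [Fintype ι] [DecidableEq ι] {x : ℝ} (hx : 0 ≤ x)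
    (hx1 : 2 * Fintype.card ι * x ≤ 1) :
    ∑ z ∈ (Finset.univ : Finset (Finset ι × Finset ι)).erase (∅, ∅), x ^ (z.1.card + z.2.card) ≤
      4 * Fintype.card ι * x := by
  have h1 : ∑ S : Finset ι, x ^ S.card = (x + 1) ^ Fintype.card ι := by
    rw [← Fintype.sum_pow_mul_eq_add_pow ι x 1]
    simp
  have h2 : ∑ z : Finset ι × Finset ι, x ^ (z.1.card + z.2.card) =
      (x + 1) ^ Fintype.card ι * (x + 1) ^ Fintype.card ι := by
    simp_rw [pow_add]
    rw [Fintype.sum_prod_type, ← h1, Finset.sum_mul_sum]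
  have h3 := Finset.add_sum_erase Finset.univ
    (fun z : Finset ι × Finset ι => x ^ (z.1.card + z.2.card)) (Finset.mem_univ (∅, ∅))
  simp only [Finset.card_empty, add_zero, pow_zero] at h3
  have h4 : (x + 1) ^ Fintype.card ι * (x + 1) ^ Fintype.card ι ≤
      Real.exp (2 * Fintype.card ι * x) := by
    have h5 : (x + 1) ^ Fintype.card ι ≤ Real.exp (Fintype.card ι * x) := by
      rw [Real.exp_nat_mul]
      exact pow_le_pow_left₀ (by linarith) (Real.add_one_le_exp x) _
    calc _ ≤ Real.exp (Fintype.card ι * x) * Real.exp (Fintype.card ι * x) := by gcongr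
      _ = _ := by rw [← Real.exp_add]; ring_nf
  have hpos : 0 ≤ 2 * Fintype.card ι * x := by positivity
  have h6 := Real.abs_exp_sub_one_le (x := 2 * Fintype.card ι * x) (by rwa [abs_of_nonneg hpos])
  rw [abs_of_nonneg hpos] at h6
  have h7 := (abs_le.mp h6).2
  linarith

end UnionBound

/-! ### Discretization of the heights. -/

section Grid

theorem exists_int_abs_sub_le {a t : ℝ} (ha : 0 < a) (ht : |t| ≤ a) {p : ℕ} (hp : 0 < p) :
    ∃ k ∈ Finset.Icc (-(p : ℤ)) p, |t - a * k / p| ≤ a / p := by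
  have hp' : (0 : ℝ) < p := by exact_mod_cast hp
  obtain ⟨h1, h2⟩ := abs_le.mp ht
  refine ⟨⌊t * p / a⌋, Finset.mem_Icc.mpr ⟨?_, ?_⟩, ?_⟩
  · rw [Int.le_floor, le_div_iff₀ ha]
    push_cast
    nlinarith
  · have h3 : ((⌊t * p / a⌋ : ℤ) : ℝ) ≤ (p : ℤ) := by
      refine (Int.floor_le _).trans ?_
      rw [div_le_iff₀ ha]
      push_cast
      nlinarith
    exact_mod_cast h3
  · have e : t - a * ⌊t * p / a⌋ / p = Int.fract (t * p / a) * (a / p) := by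
      rw [Int.fract]; field_simp
    rw [e, abs_mul, abs_of_nonneg (Int.fract_nonneg _), abs_of_pos (by positivity)]
    exact mul_le_of_le_one_left (by positivity) (Int.fract_lt_one _).le

theorem abs_sum_mul_le_add {κ : Type*} (s : Finset κ) {g g' y : κ → ℝ} {K η b : ℝ}
    (hb : ∀ q, |y q| ≤ b) (hη : ∀ q, |g q - g' q| ≤ η) (hK : |∑ q ∈ s, g' q * y q| ≤ K) :
    |∑ q ∈ s, g q * y q| ≤ K + s.card * (η * b) := by
  have e : ∑ q ∈ s, g q * y q = ∑ q ∈ s, g' q * y q + ∑ q ∈ s, (g q - g' q) * y q := by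
    rw [← Finset.sum_add_distrib]
    exact Finset.sum_congr rfl fun q _ => by ring
  rw [e]
  refine (abs_add_le _ _).trans (add_le_add hK ((Finset.abs_sum_le_sum_abs _ _).trans ?_))
  rw [← nsmul_eq_mul]
  refine Finset.sum_le_card_nsmul _ _ _ fun q _ => ?_
  rw [abs_mul]
  exact mul_le_mul (hη q) (hb q) (abs_nonneg _) ((abs_nonneg _).trans (hη q))

end Grid

/-! ### Uniform derivative bounds from (L-A1). -/

/-- A smooth function of two variables whose partial derivatives needed for the expansion
are bounded by `M`. -/
structure BoundedPartials (M : ℝ) (f : ℝ × ℝ → ℝ) : Prop where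
  contDiff : ContDiff ℝ (⊤ : ℕ∞) f
  fst : ∀ q, |partialFst f q| ≤ M
  snd : ∀ q, |partialSnd f q| ≤ M
  fst_fst : ∀ q, |partialFst (partialFst f) q| ≤ M
  snd_snd : ∀ q, |partialSnd (partialSnd f) q| ≤ M
  snd_fst : ∀ q, |partialSnd (partialFst f) q| ≤ M
  fst_snd_fst : ∀ q, |partialFst (partialSnd (partialFst f)) q| ≤ M
  snd_snd_fst : ∀ q, |partialSnd (partialSnd (partialFst f)) q| ≤ M

theorem CondLA1.exists_boundedPartials {α : ℝ} (hα : 0 < α) :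
    ∃ M : ℝ, 0 < M ∧ ∀ {p : ℕ} {l : Fin p → Fin p → ℝ → ℝ → ℝ}, CondLA1 α l →
      ∀ i j, i ≠ j → BoundedPartials M fun q => l i j q.1 q.2 := by
  -- The three terms are the bounds `(k-1)! / α ^ k` for `k = 1, 2, 3`.
  set M := α⁻¹ + (α ^ 2)⁻¹ + 2 / α ^ 3 with hM
  have e1 : 0 < α⁻¹ := by positivity
  have e2 : 0 < (α ^ 2)⁻¹ := by positivity
  have e3 : 0 < 2 / α ^ 3 := by positivity
  refine ⟨M, by positivity, fun {p l} h i j hij => ?_⟩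
  obtain ⟨hc, hb⟩ := h i j hij
  have key : ∀ s t, 1 ≤ s + t → s + t ≤ 3 → ∀ q : ℝ × ℝ,
      |(partialFst^[s] (partialSnd^[t] fun q => l i j q.1 q.2)) q| ≤ M := by
    intro s t h1 h3 q
    rw [show q = (q.1, q.2) from rfl, ← mixedPartial_eq_iterate hc]
    have := hb (s + t) h1 s (by omega) q.1 q.2
    rw [Nat.add_sub_cancel_left] at this
    refine this.trans ?_
    generalize s + t = k at h1 h3
    interval_cases k <;> norm_num [Nat.factorial] <;> linarith
  have hcomm := partialFst_partialSnd_comm hc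
  refine ⟨hc, key 1 0 (by norm_num) (by norm_num), key 0 1 (by norm_num) (by norm_num),
    key 2 0 (by norm_num) (by norm_num), key 0 2 (by norm_num) (by norm_num), ?_, ?_, ?_⟩
  · rw [← hcomm]
    exact key 1 1 (by norm_num) (by norm_num)
  · rw [← hcomm]
    exact key 2 1 (by norm_num) (by norm_num)
  · rw [← hcomm, ← partialFst_partialSnd_comm hc.partialSnd]
    exact key 1 2 (by norm_num) (by norm_num)

/-! ### Sizes of rows, columns and rectangles. -/

section Counting

variable {ι κ : Type*} [DecidableEq ι] [Fintype κ] {u v : κ → ι}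

theorem card_filter_mem_and_mem_le (huv : Function.Injective fun q => (u q, v q))
    (S T : Finset ι) :
    (Finset.univ.filter fun q => u q ∈ S ∧ v q ∈ T).card ≤ S.card * T.card := by
  rw [← Finset.card_product]
  exact Finset.card_le_card_of_injOn (fun q => (u q, v q))
    (fun q hq => by simpa using hq) huv.injOn

theorem card_filter_fst_eq_le [Fintype ι] (huv : Function.Injective fun q => (u q, v q)) (i : ι) :
    (Finset.univ.filter fun q => u q = i).card ≤ Fintype.card ι := by
  simpa using card_filter_mem_and_mem_le huv {i} Finset.univ

theorem card_filter_snd_eq_le [Fintype ι] (huv : Function.Injective fun q => (u q, v q)) (i : ι) :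
    (Finset.univ.filter fun q => v q = i).card ≤ Fintype.card ι := by
  simpa using card_filter_mem_and_mem_le huv Finset.univ {i}

end Counting

/-! ### Deterministic expansion of the increment. -/

section Expansion

/-- Expansion of an increment of a weighted sum over pairs of coordinates, given control of the
weighted sums of partial derivatives on a grid. -/
theorem abs_sum_increment_le {ι κ : Type*} [Fintype ι] [DecidableEq ι] [Fintype κ]
    {u v : κ → ι} (huv : Function.Injective fun q => (u q, v q))
    {M a b K : ℝ} (hM : 0 < M) (ha : 0 < a) (hb : 0 ≤ b) {f : κ → ℝ × ℝ → ℝ}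
    (hf : ∀ q, BoundedPartials M (f q)) (x : ι → ℝ) {y : κ → ℝ} (hy : ∀ q, |y q| ≤ b)
    {p : ℕ} (hp : 0 < p) (hcard : Fintype.card ι = p)
    (h1 : ∀ i, ∀ k ∈ Finset.Icc (-(p : ℤ)) p,
      |∑ q with u q = i, partialFst (f q) (x (u q) + a * k / p, x (v q)) * y q| ≤ K)
    (h2 : ∀ i, ∀ k ∈ Finset.Icc (-(p : ℤ)) p,
      |∑ q with v q = i, partialSnd (f q) (x (u q), x (v q) + a * k / p) * y q| ≤ K)
    (h12 : ∀ k ∈ Finset.Icc (-(p : ℤ)) p, ∀ k' ∈ Finset.Icc (-(p : ℤ)) p, ∀ S T : Finset ι,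
      |∑ q with u q ∈ S ∧ v q ∈ T,
        partialSnd (partialFst (f q)) (x (u q) + a * k / p, x (v q) + a * k' / p) * y q| ≤
          K * (S.card + T.card))
    {d : ι → ℝ} (hd : ∀ i, |d i| ≤ a) :
    |∑ q, (f q (x (u q) + d (u q), x (v q) + d (v q)) - f q (x (u q), x (v q))) * y q| ≤
      (2 + 4 * a) * (K + 2 * M * a * b) * ∑ i, |d i| := by
  have hp' : (0 : ℝ) < p := by exact_mod_cast hp
  have hrect := card_filter_mem_and_mem_le huv
  have hcardle : ∀ S : Finset ι, (S.card : ℝ) ≤ p := fun S => by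
    exact_mod_cast hcard ▸ Finset.card_le_univ S
  have hMab : 0 ≤ M * a * b := by positivity
  have hu : ∀ i, (Finset.univ.filter fun q => u q = i).card ≤ p :=
    hcard ▸ card_filter_fst_eq_le huv
  have hv : ∀ i, (Finset.univ.filter fun q => v q = i).card ≤ p :=
    hcard ▸ card_filter_snd_eq_le huv
  have hA : ∀ i t, |t| ≤ a →
      |∑ q with u q = i, partialFst (f q) (x (u q) + t, x (v q)) * y q| ≤ K + 2 * M * a * b := by
    intro i t ht
    obtain ⟨k, hk, hkt⟩ := exists_int_abs_sub_le ha ht hp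
    refine (abs_sum_mul_le_add _ hy (η := M * (a / p)) (fun q => ?_) (h1 i k hk)).trans ?_
    · refine (abs_sub_le_of_partialFst_le (hf q).contDiff.partialFst (hf q).fst_fst _ _ _).trans ?_
      rw [add_sub_add_left_eq_sub]
      gcongr
    · have : ((Finset.univ.filter fun q => u q = i).card : ℝ) * (M * (a / p) * b) ≤
          p * (M * (a / p) * b) := by gcongr; exact_mod_cast hu i
      have e : p * (M * (a / p) * b) = M * a * b := by field_simp
      linarith
  have hB : ∀ i t, |t| ≤ a →
      |∑ q with v q = i, partialSnd (f q) (x (u q), x (v q) + t) * y q| ≤ K + 2 * M * a * b := by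
    intro i t ht
    obtain ⟨k, hk, hkt⟩ := exists_int_abs_sub_le ha ht hp
    refine (abs_sum_mul_le_add _ hy (η := M * (a / p)) (fun q => ?_) (h2 i k hk)).trans ?_
    · refine (abs_sub_le_of_partialSnd_le (hf q).contDiff.partialSnd (hf q).snd_snd _ _ _).trans ?_
      rw [add_sub_add_left_eq_sub]
      gcongr
    · have : ((Finset.univ.filter fun q => v q = i).card : ℝ) * (M * (a / p) * b) ≤
          p * (M * (a / p) * b) := by gcongr; exact_mod_cast hv i
      have e : p * (M * (a / p) * b) = M * a * b := by field_simp
      linarith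
  have hC : ∀ t r, |t| ≤ a → |r| ≤ a → ∀ S T : Finset ι,
      |∑ q with u q ∈ S ∧ v q ∈ T,
        partialSnd (partialFst (f q)) (x (u q) + t, x (v q) + r) * y q| ≤
          (K + 2 * M * a * b) * (S.card + T.card) := by
    intro t r ht hr S T
    obtain ⟨k, hk, hkt⟩ := exists_int_abs_sub_le ha ht hp
    obtain ⟨k', hk', hkr⟩ := exists_int_abs_sub_le ha hr hp
    refine (abs_sum_mul_le_add _ hy (η := 2 * M * (a / p)) (fun q => ?_)
      (h12 k hk k' hk' S T)).trans ?_
    · have hs := (hf q).contDiff.partialFst.partialSnd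
      refine (abs_sub_le _ (partialSnd (partialFst (f q)) (x (u q) + a * k / p, x (v q) + r))
        _).trans ?_
      have e1 := abs_sub_le_of_partialFst_le hs (hf q).fst_snd_fst (x (u q) + t)
        (x (u q) + a * k / p) (x (v q) + r)
      have e2 := abs_sub_le_of_partialSnd_le hs (hf q).snd_snd_fst (x (u q) + a * k / p)
        (x (v q) + r) (x (v q) + a * k' / p)
      rw [add_sub_add_left_eq_sub] at e1 e2
      have e3 : M * |t - a * k / p| ≤ M * (a / p) := by gcongr
      have e4 : M * |r - a * k' / p| ≤ M * (a / p) := by gcongr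
      linarith
    -- Bounding `|S| |T|` by `|S| p` lets the grid step `a / p` cancel `p`, so the discretization
    -- error stays linear in `|S| + |T|`.
    · have e1 : ((Finset.univ.filter fun q => u q ∈ S ∧ v q ∈ T).card : ℝ) ≤ S.card * p := by
        refine le_trans (b := (S.card * T.card : ℝ)) (by exact_mod_cast hrect S T) ?_
        gcongr
        exact_mod_cast hcardle T
      have e2 : ((Finset.univ.filter fun q => u q ∈ S ∧ v q ∈ T).card : ℝ) *
          (2 * M * (a / p) * b) ≤ S.card * p * (2 * M * (a / p) * b) := by gcongr
      have e3 : S.card * p * (2 * M * (a / p) * b) = 2 * M * a * b * S.card := by field_simp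
      have e4 : 0 ≤ 2 * M * a * b * T.card := by positivity
      linarith
  have hterm : ∀ i : ι, ∀ g : ℝ → ℝ, (∀ t, |t| ≤ a → |g t| ≤ K + 2 * M * a * b) →
      |∫ t in (0 : ℝ)..d i, g t| ≤ (K + 2 * M * a * b) * |d i| := by
    intro i g hg
    have := intervalIntegral.norm_integral_le_of_norm_le_const (a := 0) (b := d i) (f := g)
      (C := K + 2 * M * a * b) fun t ht => hg t ?_
    · simpa using this
    · rw [Set.mem_uIoc] at ht
      have := abs_le.mp (hd i)
      rcases ht with ht | ht <;> exact abs_le.mpr ⟨by linarith, by linarith⟩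
  have hfirst : |∑ q, (∫ t in (0 : ℝ)..d (u q), partialFst (f q) (x (u q) + t, x (v q))) * y q| ≤
      (K + 2 * M * a * b) * ∑ i, |d i| := by
    -- Within a row all upper limits equal `d i`, so the finite sum moves inside one integral.
    rw [← Finset.sum_fiberwise Finset.univ u, Finset.mul_sum]
    refine (Finset.abs_sum_le_sum_abs _ _).trans (Finset.sum_le_sum fun i _ => ?_)
    refine le_trans (le_of_eq ?_) (hterm i _ (hA i))
    rw [intervalIntegral.integral_finsetSum]
    · congr 1
      refine Finset.sum_congr rfl fun q hq => ?_
      rw [intervalIntegral.integral_mul_const, (Finset.mem_filter.mp hq).2]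
    · intro q _
      have := (hf q).contDiff.partialFst.continuous
      exact Continuous.intervalIntegrable (by fun_prop) _ _
  have hsecond : |∑ q, (∫ t in (0 : ℝ)..d (v q), partialSnd (f q) (x (u q), x (v q) + t)) * y q| ≤
      (K + 2 * M * a * b) * ∑ i, |d i| := by
    rw [← Finset.sum_fiberwise Finset.univ v, Finset.mul_sum]
    refine (Finset.abs_sum_le_sum_abs _ _).trans (Finset.sum_le_sum fun i _ => ?_)
    refine le_trans (le_of_eq ?_) (hterm i _ (hB i))
    rw [intervalIntegral.integral_finsetSum]
    · congr 1
      refine Finset.sum_congr rfl fun q hq => ?_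
      rw [intervalIntegral.integral_mul_const, (Finset.mem_filter.mp hq).2]
    · intro q _
      have := (hf q).contDiff.partialSnd.continuous
      exact Continuous.intervalIntegrable (by fun_prop) _ _
  have hmixed : |∑ q, (∫ t in (0 : ℝ)..d (u q), ∫ r in (0 : ℝ)..d (v q),
      partialSnd (partialFst (f q)) (x (u q) + t, x (v q) + r)) * y q| ≤
      4 * a * (K + 2 * M * a * b) * ∑ i, |d i| := by
    simp_rw [← intervalIntegral.integral_mul_const]
    refine abs_sum_iterated_integral_le u v (fun q t r =>
      partialSnd (partialFst (f q)) (x (u q) + t, x (v q) + r) * y q) (fun q => ?_) d hd ?_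
    · have := (hf q).contDiff.partialFst.partialSnd.continuous
      simp only [Function.uncurry_def]
      fun_prop
    · intro t r ht hr S T
      convert hC t r ht hr S T
  simp_rw [fun q => sub_eq_integral_partial (hf q).contDiff, add_mul, Finset.sum_add_distrib]
  refine (abs_add_le _ _).trans ?_
  have := abs_add_le
    (∑ q, (∫ t in (0 : ℝ)..d (u q), partialFst (f q) (x (u q) + t, x (v q))) * y q)
    (∑ q, (∫ t in (0 : ℝ)..d (v q), partialSnd (f q) (x (u q), x (v q) + t)) * y q)
  linarith

end Expansion

/-! ### Probability of the good event and conclusion. -/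

/-- Simultaneous control of the weighted sums over all rows, columns and rectangles, for weights
indexed by grid points. -/
theorem measureReal_grid_failure_le {Ω ι κ : Type*} [MeasurableSpace Ω] {P : Measure Ω}
    [IsProbabilityMeasure P] [Fintype ι] [DecidableEq ι] [Fintype κ]
    {u v : κ → ι} (huv : Function.Injective fun q => (u q, v q))
    {Y : κ → Ω → ℝ} {b σ M A L : ℝ}
    (hY : ∀ i, Measurable (Y i)) (hind : iIndepFun Y P)
    (hb : 0 ≤ b) (hσ : 0 ≤ σ) (hM : 0 ≤ M) (hA : 1 ≤ A) (hL : 0 < L)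
    (hB : ∀ i, ∀ᵐ ω ∂P, |Y i ω| ≤ b) (h0 : ∀ i, ∫ ω, Y i ω ∂P = 0)
    (hv : ∀ i, variance (Y i) P ≤ σ ^ 2)
    {w₁ w₂ : ℤ → κ → ℝ} {w₁₂ : ℤ → ℤ → κ → ℝ} (hw₁ : ∀ k q, |w₁ k q| ≤ M)
    (hw₂ : ∀ k q, |w₂ k q| ≤ M) (hw₁₂ : ∀ k k' q, |w₁₂ k k' q| ≤ M)
    {p : ℕ} (hp : 0 < p) (hcard : Fintype.card ι = p)
    (hsmall : 2 * p * Real.exp (-(A * L)) ≤ 1) {K : ℝ}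
    (hK : K = 2 * M * A * (b * L + σ * √(p * L))) :
    P.real {ω | ¬ ((∀ q, |Y q ω| ≤ b) ∧
      (∀ i, ∀ k ∈ Finset.Icc (-(p : ℤ)) p, |∑ q with u q = i, w₁ k q * Y q ω| ≤ K) ∧
      (∀ i, ∀ k ∈ Finset.Icc (-(p : ℤ)) p, |∑ q with v q = i, w₂ k q * Y q ω| ≤ K) ∧
      (∀ k ∈ Finset.Icc (-(p : ℤ)) p, ∀ k' ∈ Finset.Icc (-(p : ℤ)) p, ∀ S T : Finset ι,
        |∑ q with u q ∈ S ∧ v q ∈ T, w₁₂ k k' q * Y q ω| ≤ K * (S.card + T.card)))} ≤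
      84 * p ^ 3 * Real.exp (-(A * L)) := by
  set I := Finset.Icc (-(p : ℤ)) p with hI
  set x := Real.exp (-(A * L)) with hx
  have hx0 : 0 < x := Real.exp_pos _
  have hp1 : (1 : ℝ) ≤ p := by exact_mod_cast hp
  have hIcard : (I.card : ℝ) ≤ 3 * p := by
    have : I.card = 2 * p + 1 := by rw [hI, Int.card_Icc]; omega
    rw [this]; push_cast; linarith
  have hrect := card_filter_mem_and_mem_le huv
  have hu' : ∀ i, (Finset.univ.filter fun q => u q = i).card ≤ p :=
    hcard ▸ card_filter_fst_eq_le huv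
  have hv' : ∀ i, (Finset.univ.filter fun q => v q = i).card ≤ p :=
    hcard ▸ card_filter_snd_eq_le huv
  set F : Finset (ι × ℤ) := Finset.univ ×ˢ I with hF
  have hFsum : ∑ k ∈ F, 2 * x ^ 1 ≤ 6 * p ^ 2 * x := by
    rw [Finset.sum_const, hF, Finset.card_product, Finset.card_univ, hcard, nsmul_eq_mul]
    push_cast
    have : (p : ℝ) * I.card ≤ p * (3 * p) := by gcongr
    nlinarith
  -- The pair `(∅, ∅)` is left out: it has size `0`, where Bernstein gives no gain, and its sum is
  -- zero anyway.
  set G : Finset ((ℤ × ℤ) × (Finset ι × Finset ι)) :=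
    (I ×ˢ I) ×ˢ (Finset.univ.erase (∅, ∅)) with hG
  have hGsum : ∑ k ∈ G, 2 * x ^ (k.2.1.card + k.2.2.card) ≤ 72 * p ^ 3 * x := by
    rw [hG, Finset.sum_product]
    simp only
    rw [Finset.sum_const, Finset.card_product, nsmul_eq_mul, ← Finset.mul_sum]
    have h1 := sum_pow_card_erase_empty_le (ι := ι) hx0.le (by rw [hcard]; exact hsmall)
    rw [hcard] at h1
    push_cast
    calc (I.card : ℝ) * I.card * (2 * _) ≤ (3 * p) * (3 * p) * (2 * (4 * p * x)) := by gcongr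
      _ = 72 * p ^ 3 * x := by ring
  have hE₁ := measureReal_exists_abs_sum_gt_le (p := p) hY hind hb hσ hM hA hL hB h0 hv F
    (w := fun k => w₁ k.2) (fun k q => hw₁ k.2 q)
    (fun k => Finset.univ.filter fun q => u q = k.1) (fun _ => 1) (fun _ _ => le_rfl)
    (fun k _ => by simpa using hu' k.1)
  have hE₂ := measureReal_exists_abs_sum_gt_le (p := p) hY hind hb hσ hM hA hL hB h0 hv F
    (w := fun k => w₂ k.2) (fun k q => hw₂ k.2 q)
    (fun k => Finset.univ.filter fun q => v q = k.1) (fun _ => 1) (fun _ _ => le_rfl)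
    (fun k _ => by simpa using hv' k.1)
  have hE₁₂ := measureReal_exists_abs_sum_gt_le (p := p) hY hind hb hσ hM hA hL hB h0 hv G
    (w := fun k => w₁₂ k.1.1 k.1.2) (fun k q => hw₁₂ k.1.1 k.1.2 q)
    (fun k => Finset.univ.filter fun q => u q ∈ k.2.1 ∧ v q ∈ k.2.2)
    (fun k => k.2.1.card + k.2.2.card)
    (fun k hk => by
      have hne : k.2 ≠ (∅, ∅) := (Finset.mem_erase.mp (Finset.mem_product.mp hk).2).1
      by_contra hlt
      refine hne (Prod.ext (Finset.card_eq_zero.mp ?_) (Finset.card_eq_zero.mp ?_)) <;> omega)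
    (fun k _ => by
      have h1 : k.2.2.card ≤ p := hcard ▸ Finset.card_le_univ _
      have h2 := (hrect k.2.1 k.2.2).trans (Nat.mul_le_mul_left _ h1)
      have h3 : (Finset.univ.filter fun q => u q ∈ k.2.1 ∧ v q ∈ k.2.2).card ≤
          p * (k.2.1.card + k.2.2.card) := by nlinarith
      exact_mod_cast h3)
  rw [← hK] at hE₁ hE₂ hE₁₂
  set E₁ := {ω | ∃ k ∈ F, K * ((1 : ℕ) : ℝ) <
    |∑ i ∈ Finset.univ.filter (fun q => u q = k.1), w₁ k.2 i * Y i ω|} with hE₁def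
  set E₂ := {ω | ∃ k ∈ F, K * ((1 : ℕ) : ℝ) <
    |∑ i ∈ Finset.univ.filter (fun q => v q = k.1), w₂ k.2 i * Y i ω|} with hE₂def
  set E₁₂ := {ω | ∃ k ∈ G, K * ((k.2.1.card + k.2.2.card : ℕ) : ℝ) <
    |∑ i ∈ Finset.univ.filter (fun q => u q ∈ k.2.1 ∧ v q ∈ k.2.2),
      w₁₂ k.1.1 k.1.2 i * Y i ω|} with hE₁₂def
  set E₀ := {ω | ¬ ∀ q, |Y q ω| ≤ b} with hE₀def
  have hE₀ : P.real E₀ = 0 := by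
    have : ∀ᵐ ω ∂P, ∀ q, |Y q ω| ≤ b := ae_all_iff.mpr hB
    rw [measureReal_def, show P E₀ = 0 from this, ENNReal.toReal_zero]
  refine (measureReal_mono (s₂ := E₀ ∪ (E₁ ∪ (E₂ ∪ E₁₂))) ?_).trans ?_
  · intro ω hω
    by_contra hc
    simp only [Set.mem_union, not_or] at hc
    obtain ⟨c0, c1, c2, c3⟩ := hc
    simp only [hE₀def, hE₁def, hE₂def, hE₁₂def, Set.mem_ofPred_eq, not_exists, not_and,
      not_lt, not_not] at c0 c1 c2 c3 hω
    refine hω c0 ?_ ?_ ?_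
    · intro i k hk
      simpa using c1 (i, k) (Finset.mem_product.mpr ⟨Finset.mem_univ _, hk⟩)
    · intro i k hk
      simpa using c2 (i, k) (Finset.mem_product.mpr ⟨Finset.mem_univ _, hk⟩)
    · intro k hk k' hk' S T
      by_cases hST : (S, T) = (∅, ∅)
      · obtain ⟨rfl, rfl⟩ := Prod.mk.inj hST
        simp
      · have := c3 ((k, k'), (S, T)) (Finset.mem_product.mpr
          ⟨Finset.mem_product.mpr ⟨hk, hk'⟩, Finset.mem_erase.mpr ⟨hST, Finset.mem_univ _⟩⟩)
        simpa using this
  -- The total `84` is `6 + 6 + 72`: rows, columns, rectangles.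
  · have i1 := measureReal_union_le (μ := P) E₀ (E₁ ∪ (E₂ ∪ E₁₂))
    have i2 := measureReal_union_le (μ := P) E₁ (E₂ ∪ E₁₂)
    have i3 := measureReal_union_le (μ := P) E₂ E₁₂
    have hp23 : (p : ℝ) ^ 2 * x ≤ p ^ 3 * x := by
      gcongr
      norm_num
    linarith

theorem theorem5 (α : ℝ) (hα : 0 < α) (α₀ : ℝ) (hα₀ : 0 < α₀) (hα₀' : α₀ < α / 2)
    (c : ℝ) (hc : 0 < c) :
    ∃ C : ℝ, 0 < C ∧ ∃ N : ℕ, ∀ n p : ℕ, N ≤ n * p →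
      ∀ (Ω : Type*) [MeasurableSpace Ω] (P : Measure Ω) [IsProbabilityMeasure P]
        (l : Fin p → Fin p → ℝ → ℝ → ℝ) (Y : Fin p → Fin p → Ω → ℝ) (b σ : ℝ),
        CondLA1 α l → CondLA2 P b σ Y →
        ∀ θ' : Fin p → ℝ,
          P.real {ω | ∀ θ : Fin p → ℝ, (∀ i, |θ i - θ' i| ≤ α₀) →
              |pairSum l Y θ ω - pairSum l Y θ' ω| ≤
                C * ((b * Real.log ((n : ℝ) * p) + σ * Real.sqrt (p * Real.log ((n : ℝ) * p))) / p)
                  * ∑ i, |θ i - θ' i|}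
            > 1 - ((n : ℝ) * p) ^ (-c) := by
  obtain ⟨M, hM, hbd⟩ := CondLA1.exists_boundedPartials hα
  -- In the second factor, `2 * M * (c + 4)` comes from Bernstein and `2 * M * α₀` from the grid.
  -- With `A = c + 4`, three powers of `np` absorb `p ^ 3` and the fourth, being at least `100`,
  -- beats `84` strictly.
  refine ⟨(2 + 4 * α₀) * (2 * M * (c + 4) + 2 * M * α₀), by positivity, 100, ?_⟩
  intro n p hnp Ω _ P _ l Y b σ hl hY θ'
  have hp : 0 < p := by
    rcases Nat.eq_zero_or_pos p with h | h
    · subst h; omega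
    · exact h
  have hn : 0 < n := by
    rcases Nat.eq_zero_or_pos n with h | h
    · subst h; omega
    · exact h
  have hp1 : (1 : ℝ) ≤ p := by exact_mod_cast hp
  have hn1 : (1 : ℝ) ≤ n := by exact_mod_cast hn
  set R : ℝ := (n : ℝ) * p with hR
  have hR100 : 100 ≤ R := by rw [hR]; exact_mod_cast hnp
  have hR0 : 0 < R := by linarith
  have hpR : (p : ℝ) ≤ R := by rw [hR]; nlinarith
  set L := Real.log R with hL
  have hL1 : 1 ≤ L := by
    rw [hL, Real.le_log_iff_exp_le hR0]
    linarith [Real.exp_one_lt_d9]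
  set A := c + 4 with hA
  have hexp : Real.exp (-(A * L)) * R ^ 4 = R ^ (-c) := by
    rw [← Real.rpow_natCast R 4, Real.rpow_def_of_pos hR0, Real.rpow_def_of_pos hR0,
      ← Real.exp_add, hA, hL]
    congr 1
    push_cast
    ring
  have hRc : R ^ (-c) ≤ 1 := Real.rpow_le_one_of_one_le_of_nonpos (by linarith) (by linarith)
  have hRc0 : 0 < R ^ (-c) := Real.rpow_pos_of_pos hR0 _
  set x := Real.exp (-(A * L)) with hx
  have hx0 : 0 < x := Real.exp_pos _
  have hp3 : (p : ℝ) ^ 3 * x * 100 ≤ R ^ (-c) := by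
    rw [← hexp]
    calc (p : ℝ) ^ 3 * x * 100 ≤ R ^ 3 * x * R := by gcongr
      _ = x * R ^ 4 := by ring
  have hsmall : 2 * p * x ≤ 1 := by
    have : (p : ℝ) * x ≤ p ^ 3 * x := by
      gcongr
      exact le_self_pow₀ hp1 (by norm_num)
    linarith
  set K := 2 * M * A * (b * L + σ * √(p * L)) with hK
  let Q := {q : Fin p × Fin p // q.1 ≠ q.2}
  let f : Q → ℝ × ℝ → ℝ := fun q z => l q.1.1 q.1.2 z.1 z.2
  have hf : ∀ q, BoundedPartials M (f q) := fun q => hbd hl q.1.1 q.1.2 q.2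
  have huv : Function.Injective fun q : Q => (q.1.1, q.1.2) := fun q q' h => Subtype.ext h
  have hfail := measureReal_grid_failure_le (P := P) (u := fun q : Q => q.1.1)
    (v := fun q : Q => q.1.2) huv (Y := fun q => Y q.1.1 q.1.2)
    (fun q => hY.measurable _ _ q.2) hY.indep hY.b_nonneg hY.σ_nonneg hM.le
    (show 1 ≤ A by linarith) (show 0 < L by linarith) (fun q => hY.bounded _ _ q.2)
    (fun q => hY.centered _ _ q.2) (fun q => hY.variance_le _ _ q.2)
    (w₁ := fun k q => partialFst (f q) (θ' q.1.1 + α₀ * k / p, θ' q.1.2))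
    (w₂ := fun k q => partialSnd (f q) (θ' q.1.1, θ' q.1.2 + α₀ * k / p))
    (w₁₂ := fun k k' q =>
      partialSnd (partialFst (f q)) (θ' q.1.1 + α₀ * k / p, θ' q.1.2 + α₀ * k' / p))
    (fun k q => (hf q).fst _) (fun k q => (hf q).snd _) (fun k k' q => (hf q).snd_fst _)
    hp (Fintype.card_fin p) hsmall hK
  set good := {ω | ∀ θ : Fin p → ℝ, (∀ i, |θ i - θ' i| ≤ α₀) →
    |pairSum l Y θ ω - pairSum l Y θ' ω| ≤ (2 + 4 * α₀) * (2 * M * A + 2 * M * α₀) *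
      ((b * L + σ * √(p * L)) / p) * ∑ i, |θ i - θ' i|} with hgood
  rw [← hx] at hfail
  set bad := {ω | ¬ _} with hbad
  have hcover : bad ∪ good = Set.univ := by
    refine Set.eq_univ_of_forall fun ω => ?_
    by_cases hω : ω ∈ bad
    · exact Or.inl hω
    refine Or.inr ?_
    rw [hbad, Set.mem_ofPred_eq, not_not] at hω
    obtain ⟨g0, g1, g2, g12⟩ := hω
    intro θ hθ
    have hmain := abs_sum_increment_le huv hM hα₀ hY.b_nonneg hf θ' g0 hp (Fintype.card_fin p)
      g1 g2 g12 (d := fun i => θ i - θ' i) hθ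
    simp only [add_sub_cancel] at hmain
    have hsum : ∀ θ : Fin p → ℝ, pairSum l Y θ ω =
        (1 / (p : ℝ)) * ∑ q : Q, f q (θ q.1.1, θ q.1.2) * Y q.1.1 q.1.2 ω := by
      intro θ
      rw [pairSum, Finset.sum_subtype (p := fun q : Fin p × Fin p => q.1 ≠ q.2) _ (by simp)]
    rw [hsum, hsum, ← mul_sub, ← Finset.sum_sub_distrib, abs_mul, abs_of_pos (by positivity)]
    simp_rw [← sub_mul]
    -- Since `L ≥ 1`, the grid error, proportional to `b`, is absorbed into the main rate.
    have hbL : b ≤ b * L + σ * √(p * L) := by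
      have h1 : b * 1 ≤ b * L := mul_le_mul_of_nonneg_left hL1 hY.b_nonneg
      have h2 : 0 ≤ σ * √(p * L) := mul_nonneg hY.σ_nonneg (Real.sqrt_nonneg _)
      linarith
    calc 1 / (p : ℝ) * _ ≤ 1 / (p : ℝ) *
          ((2 + 4 * α₀) * (K + 2 * M * α₀ * b) * ∑ i, |θ i - θ' i|) := by gcongr
      _ ≤ 1 / (p : ℝ) * ((2 + 4 * α₀) *
          (K + 2 * M * α₀ * (b * L + σ * √(p * L))) * ∑ i, |θ i - θ' i|) := by gcongr
      _ = _ := by rw [hK]; ring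
  -- Subadditivity of the cover `bad ∪ good` avoids any measurability claim about `good`, an
  -- intersection over uncountably many `θ`.
  have h1 : (1 : ℝ) ≤ P.real bad + P.real good := by
    rw [← probReal_univ (μ := P), ← hcover]
    exact measureReal_union_le _ _
  change 1 - R ^ (-c) < P.real good
  linarith
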